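/- A set $A$ of ordinals is called nowhere stationary if, for every ordinal $\alpha$ of uncountable cofinality, $A\cap\alpha$ is not stationary in $\alpha$; a set of cardinals is regarded as a set of (initial) ordinals. A hypergraph on a set $V$ is a family $\mathcal E$ of non-empty subsets (edges) of $V$. A vertex cover of $\mathcal E$ is a set $Y\subseteq\bigcup\mathcal E$ with $Y\cap E\neq\emptyset$ for every $E\in\mathcal E$; it is minimal if no proper subset of $Y$ is a vertex cover of $\mathcal E$. **Theorem.** Let $S$ be a nowhere stationary set of cardinals, let $\lambda$ be any cardinal and let $r<\omega$. Let $\mathcal E\subseteq[\lambda]^{S}=\{B\subseteq\lambda : |B|\in S\}$ be a hypergraph with property $C(2,r)$, that is, $|E\cap E'|<r$ for any two distinct $E,E'\in\mathcal E$. Then $\mathcal E$ has a minimal vertex cover. -/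

import Mathlib

universe u

/-- A set `A` of ordinals is nowhere stationary if `A ∩ α` is not stationary in `α` (the set of
ordinals below `α`) for every ordinal `α` of uncountable cofinality. -/
def NowhereStationary (A : Set Ordinal.{u}) : Prop :=
  ∀ α : Ordinal.{u}, Cardinal.aleph0 < α.cof →
    ¬ IsStationary ((fun x : Set.Iio α => (x : Ordinal.{u})) ⁻¹' A)

/-- A set of cardinals is nowhere stationary if the set of the corresponding initial ordinals is. -/
def NowhereStationaryCardinals (S : Set Cardinal.{u}) : Prop :=
  NowhereStationary (Cardinal.ord '' S)

namespace Hypergraphs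

variable {V : Type u}

/-- A family of subsets of `V` is (the edge set of) a hypergraph if its members are non-empty. -/
def IsHypergraph (𝓔 : Set (Set V)) : Prop :=
  ∀ E ∈ 𝓔, E.Nonempty

/-- `[V]^S`, the family of the subsets of `V` whose cardinality belongs to `S`. -/
def subsetsOfSize (V : Type u) (S : Set Cardinal.{u}) : Set (Set V) :=
  {B | Cardinal.mk B ∈ S}

/-- Property `C(k, ρ)`: any `k` distinct edges have fewer than `ρ` points in common. -/
def PropertyC (𝓔 : Set (Set V)) (k : ℕ) (ρ : Cardinal.{u}) : Prop :=
  ∀ 𝓕 : Set (Set V), 𝓕 ⊆ 𝓔 → Cardinal.mk 𝓕 = k → Cardinal.mk (⋂₀ 𝓕 : Set V) < ρ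

/-- A vertex cover is a set of vertices of the hypergraph that meets every edge. -/
def IsVertexCover (𝓔 : Set (Set V)) (Y : Set V) : Prop :=
  Y ⊆ ⋃₀ 𝓔 ∧ ∀ E ∈ 𝓔, (Y ∩ E).Nonempty

/-- A vertex cover is minimal if none of its proper subsets is a vertex cover. -/
def IsMinimalVertexCover (𝓔 : Set (Set V)) (Y : Set V) : Prop :=
  IsVertexCover 𝓔 Y ∧ ∀ Z : Set V, Z ⊂ Y → ¬ IsVertexCover 𝓔 Z

/-- `M(lam, S, k, ρ) → MinVC`: on a vertex set of cardinality `lam`, every hypergraph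
`𝓔 ⊆ [lam]^S` with property `C(k, ρ)` has a minimal vertex cover. -/
def MinVC (lam : Cardinal.{u}) (S : Set Cardinal.{u}) (k : ℕ) (ρ : Cardinal.{u}) : Prop :=
  ∀ V : Type u, Cardinal.mk V = lam →
    ∀ 𝓔 : Set (Set V), IsHypergraph 𝓔 → 𝓔 ⊆ subsetsOfSize V S → PropertyC 𝓔 k ρ →
      ∃ Y : Set V, IsMinimalVertexCover 𝓔 Y

end Hypergraphs

/-! A cover is minimal as soon as each of its points has a private edge, which meets the cover in
that point only. Such a cover is built by transfinite recursion along an enumeration of the edges: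
pick a point `y` in an unmet edge, give it a private edge `F`, and forbid the other points of `F`.
The danger is that the set `R` of decided points swallows an unmet edge. `IsPartialCover` prevents
this: an unmet finite edge keeps a point outside `R`; an unmet infinite edge either has a trace on
`R` smaller than itself or contains what is left of an unmet finite edge, and is then met along with
it.

To survive limits, `R` is split into a core of fewer than `θ` points and fewer than `θ` large edges.
An edge of size at least all earlier bounds should outweigh both parts, since it meets each large
edge in a finite set. For a smaller edge, a large edge is admitted only if it adds nothing to it,
unless a finite trace protects it (`IsPartialCover.exists_insert`). After each step the small
infinite edges with `r` points in the core get met (`Extendable`), so an unmet one has fewer than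
`r` points there. Meeting them means covering traces inside a smaller closed set, by induction on
the number of vertices (`extendable_succ`). Traces of finite edges may have any finite size, so only
infinite sizes are required to be in `S`.

What remains is an edge whose size is the exact supremum of the earlier bounds. Nowhere stationarity
yields cofinally many cardinals whose limits avoid `S` (`exists_cofinal_avoiding`), and the sizes
are taken from these. -/

namespace Hypergraphs

open Cardinal Set

variable {V : Type u}

/-! ### Partial covers and traces of finite edges -/

/-- Any two distinct members of the family have fewer than `r` points in common. -/
def AlmostDisjoint (𝓔 : Set (Set V)) (r : ℕ) : Prop :=
  ∀ E ∈ 𝓔, ∀ E' ∈ 𝓔, E ≠ E' → (E ∩ E').encard < r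

theorem AlmostDisjoint.finite_inter {𝓔 : Set (Set V)} {r : ℕ} (h : AlmostDisjoint 𝓔 r)
    {E E' : Set V} (hE : E ∈ 𝓔) (hE' : E' ∈ 𝓔) (hne : E ≠ E') : (E ∩ E').Finite :=
  Set.encard_lt_top_iff.1 ((h E hE E' hE' hne).trans_le le_top)

/-- Some finite edge disjoint from `Y` is contained in `E` outside of `R`. -/
def ContainsFiniteTrace (𝓔 : Set (Set V)) (Y R E : Set V) : Prop :=
  ∃ F ∈ 𝓔, F.Finite ∧ Disjoint F Y ∧ F \ R ⊆ E

/-- A partial cover: the points of `Y` have been chosen, each of them is the only chosen point of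
some edge inside `R`, and no further point of `R` will be chosen. The edges that are disjoint from
`Y` can still be met outside of `R`. -/
structure IsPartialCover (𝓔 : Set (Set V)) (Y R : Set V) : Prop where
  subset : Y ⊆ R
  exists_private : ∀ y ∈ Y, ∃ E ∈ 𝓔, E ⊆ R ∧ Y ∩ E = {y}
  finite_not_subset : ∀ E ∈ 𝓔, E.Finite → Disjoint E Y → ¬ E ⊆ R
  infinite_trace : ∀ E ∈ 𝓔, E.Infinite → Disjoint E Y →
    #(E ∩ R : Set V) < #E ∨ ContainsFiniteTrace 𝓔 Y R E

/-- A minimal vertex cover, with minimality expressed through private edges. -/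
def IsPrivateCover (𝓔 : Set (Set V)) (Y : Set V) : Prop :=
  (∀ E ∈ 𝓔, (Y ∩ E).Nonempty) ∧ ∀ y ∈ Y, ∃ E ∈ 𝓔, Y ∩ E = {y}

theorem IsPrivateCover.subset_sUnion {𝓔 : Set (Set V)} {Y : Set V} (h : IsPrivateCover 𝓔 Y) :
    Y ⊆ ⋃₀ 𝓔 := by
  intro y hy
  obtain ⟨E, hE, hYE⟩ := h.2 y hy
  have : y ∈ Y ∩ E := by rw [hYE]; rfl
  exact ⟨E, hE, this.2⟩

theorem IsPrivateCover.isMinimalVertexCover {𝓔 : Set (Set V)} {Y : Set V}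
    (h : IsPrivateCover 𝓔 Y) : IsMinimalVertexCover 𝓔 Y := by
  refine ⟨⟨h.subset_sUnion, h.1⟩, fun Z hZ hcov => ?_⟩
  obtain ⟨y, hy, hyZ⟩ := Set.exists_of_ssubset hZ
  obtain ⟨E, hE, hYE⟩ := h.2 y hy
  obtain ⟨z, hz⟩ := hcov.2 E hE
  have hzy : z ∈ Y ∩ E := ⟨hZ.1 hz.1, hz.2⟩
  rw [hYE] at hzy
  exact hyZ (hzy ▸ hz.1)

theorem mk_inter_union_finite_lt {E A B : Set V} (hE : E.Infinite)
    (hA : #(E ∩ A : Set V) < #E) (hB : (E ∩ B).Finite) : #(E ∩ (A ∪ B) : Set V) < #E := by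
  rw [inter_union_distrib_left]
  refine (mk_union_le _ _).trans_lt (add_lt_of_lt ?_ hA ?_)
  · exact Cardinal.aleph0_le_mk_iff.2 hE.to_subtype
  · exact (lt_aleph0_iff_set_finite.2 hB).trans_le
      (Cardinal.aleph0_le_mk_iff.2 hE.to_subtype)

/-- The alternative `ContainsFiniteTrace` persists as long as the edge is not met. -/
theorem ContainsFiniteTrace.mono {𝓔 : Set (Set V)} {Y R Y' R' E : Set V}
    (h : ContainsFiniteTrace 𝓔 Y R E) (hR : R ⊆ R') (hYR : Y' ∩ R ⊆ Y) (hE : Disjoint E Y') :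
    ContainsFiniteTrace 𝓔 Y' R' E := by
  obtain ⟨F, hF, hfin, hdis, hsub⟩ := h
  refine ⟨F, hF, hfin, ?_, fun x hx => hsub ⟨hx.1, fun h => hx.2 (hR h)⟩⟩
  rw [Set.disjoint_left] at *
  intro x hxF hxY
  by_cases hxR : x ∈ R
  · exact hdis hxF (hYR ⟨hxY, hxR⟩)
  · exact hE (hsub ⟨hxF, hxR⟩) hxY

/-- Among the traces outside `R` of finite edges disjoint from `Y`, every one contains a minimal
one. -/
theorem exists_minimal_trace (𝓔 : Set (Set V)) (Y R : Set V) {G : Set V} (hG : G ∈ 𝓔)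
    (hfin : G.Finite) (hdis : Disjoint G Y) :
    ∃ F ∈ 𝓔, F.Finite ∧ Disjoint F Y ∧ F \ R ⊆ G \ R ∧
      ∀ F' ∈ 𝓔, F'.Finite → Disjoint F' Y → F' \ R ⊆ F \ R → F \ R ⊆ F' \ R := by
  induction hn : (G \ R).ncard using Nat.strong_induction_on generalizing G with
  | _ n ih =>
    by_cases h : ∀ F' ∈ 𝓔, F'.Finite → Disjoint F' Y → F' \ R ⊆ G \ R → G \ R ⊆ F' \ R
    · exact ⟨G, hG, hfin, hdis, subset_rfl, h⟩
    · push Not at h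
      obtain ⟨F', hF', hfin', hdis', hsub, hns⟩ := h
      have hlt : (F' \ R).ncard < n := by
        rw [← hn]
        exact Set.ncard_lt_ncard ⟨hsub, hns⟩ hfin.sdiff
      obtain ⟨F, hF, h1, h2, h3, h4⟩ := ih _ hlt hF' hfin' hdis' rfl
      exact ⟨F, hF, h1, h2, h3.trans hsub, h4⟩

/-- This is what the invariants are for: an unmet edge can still be met. If `L` were inside `R`, its
trace would not be smaller than `L`, and a finite edge with trace in `L` would be inside `R` as
well. -/
theorem IsPartialCover.diff_nonempty {𝓔 : Set (Set V)} {Y R L : Set V}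
    (h : IsPartialCover 𝓔 Y R) (hL : L ∈ 𝓔) (hdis : Disjoint L Y) : (L \ R).Nonempty := by
  rw [Set.sdiff_nonempty]
  intro hsub
  by_cases hfin : L.Finite
  · exact h.finite_not_subset L hL hfin hdis hsub
  · rcases h.infinite_trace L hL hfin hdis with hlt | ⟨F, hF, hFfin, hFdis, hFsub⟩
    · rw [inter_eq_left.2 hsub] at hlt
      exact hlt.false
    · refine h.finite_not_subset F hF hFfin hFdis fun x hx => ?_
      by_contra hxR
      exact hxR (hsub (hFsub ⟨hx, hxR⟩))

/-- Adding one point `y` with private edge `F` to a partial cover. -/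
theorem IsPartialCover.insert_point {𝓔 : Set (Set V)} {r : ℕ} (hr : AlmostDisjoint 𝓔 r)
    {Y R F : Set V} {y : V} (h : IsPartialCover 𝓔 Y R) (hF : F ∈ 𝓔) (hdis : Disjoint F Y)
    (hyF : y ∈ F) (hyR : y ∉ R)
    (hfin : ∀ G ∈ 𝓔, G.Finite → Disjoint G (insert y Y) → ¬ G ⊆ R ∪ F) :
    IsPartialCover 𝓔 (insert y Y) (R ∪ F) := by
  refine ⟨?_, ?_, hfin, ?_⟩
  · exact insert_subset (Or.inr hyF) (h.subset.trans subset_union_left)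
  · rintro z (rfl | hz)
    · refine ⟨F, hF, subset_union_right, ?_⟩
      rw [insert_inter_of_mem hyF, hdis.symm.inter_eq]
      simp
    · obtain ⟨E, hE, hER, hYE⟩ := h.exists_private z hz
      refine ⟨E, hE, hER.trans subset_union_left, ?_⟩
      rw [insert_inter_of_notMem (fun hy => hyR (hER hy)), hYE]
  · intro E hE hinf hEdis
    have hEY : Disjoint E Y := hEdis.mono_right (subset_insert _ _)
    rcases h.infinite_trace E hE hinf hEY with hlt | halt
    · left
      refine mk_inter_union_finite_lt hinf hlt (hr.finite_inter hE hF ?_)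
      rintro rfl
      exact Set.disjoint_left.1 hEdis hyF (mem_insert _ _)
    · right
      refine halt.mono subset_union_left ?_ hEdis
      rintro x ⟨rfl | hx, hxR⟩
      · exact absurd hxR hyR
      · exact hx

/-- A partial cover can be extended by a point of a given edge `L`. The private edge `F` of the
new point is small, or no small infinite edge that matters meets it outside of `R`. -/
theorem IsPartialCover.exists_insert {𝓔 : Set (Set V)} {r : ℕ} (hr : AlmostDisjoint 𝓔 r)
    {Y R L : Set V} (h : IsPartialCover 𝓔 Y R) (hL : L ∈ 𝓔) (hdis : Disjoint L Y)
    {θ : Cardinal.{u}} (hθ : ℵ₀ ≤ θ) :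
    ∃ y ∈ L, ∃ F ∈ 𝓔, y ∉ R ∧ y ∈ F ∧ IsPartialCover 𝓔 (insert y Y) (R ∪ F) ∧
      (#F < θ ∨ ∀ E ∈ 𝓔, E.Infinite → #E < θ → Disjoint E Y →
        E ∩ F ⊆ R ∨ ContainsFiniteTrace 𝓔 Y R E) := by
  -- A finite edge with minimal trace meeting `L` is the best private edge: a finite edge trapped in
  -- `R ∪ F` has the same trace as `F`, hence contains `y`.
  by_cases hA : ∃ G ∈ 𝓔, G.Finite ∧ Disjoint G Y ∧ (L ∩ (G \ R)).Nonempty ∧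
      ∀ F' ∈ 𝓔, F'.Finite → Disjoint F' Y → F' \ R ⊆ G \ R → G \ R ⊆ F' \ R
  · obtain ⟨F, hF, hFfin, hFdis, ⟨y, hyL, hyF, hyR⟩, hmin⟩ := hA
    refine ⟨y, hyL, F, hF, hyR, hyF, h.insert_point hr hF hFdis hyF hyR ?_, Or.inl ?_⟩
    · intro G hG hGfin hGdis hsub
      have hGY : Disjoint G Y := hGdis.mono_right (subset_insert _ _)
      have hGF : G \ R ⊆ F \ R := fun x hx => ⟨(hsub hx.1).resolve_left hx.2, hx.2⟩
      have := hmin G hG hGfin hGY hGF ⟨hyF, hyR⟩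
      exact Set.disjoint_left.1 hGdis this.1 (mem_insert _ _)
    · exact (lt_aleph0_iff_set_finite.2 hFfin).trans_le hθ
  -- Next best is a small infinite edge without a finite trace; a trapped finite edge would give it
  -- one.
  by_cases hB : ∃ E ∈ 𝓔, E.Infinite ∧ #E < θ ∧ Disjoint E Y ∧ ¬ E ∩ L ⊆ R ∧
      ¬ ContainsFiniteTrace 𝓔 Y R E
  · obtain ⟨F, hF, hFinf, hFθ, hFdis, hne, hnalt⟩ := hB
    obtain ⟨y, ⟨hyF, hyL⟩, hyR⟩ := Set.not_subset.1 hne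
    refine ⟨y, hyL, F, hF, hyR, hyF, h.insert_point hr hF hFdis hyF hyR ?_, Or.inl hFθ⟩
    intro G hG hGfin hGdis hsub
    exact hnalt ⟨G, hG, hGfin, hGdis.mono_right (subset_insert _ _),
      fun x hx => (hsub hx.1).resolve_left hx.2⟩
  -- Otherwise `L` is its own private edge. A trapped finite edge would yield a minimal trace inside
  -- `L`, against the failure of `hA`.
  obtain ⟨y, hyL, hyR⟩ := h.diff_nonempty hL hdis
  refine ⟨y, hyL, L, hL, hyR, hyL, h.insert_point hr hL hdis hyL hyR ?_, Or.inr ?_⟩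
  · intro G hG hGfin hGdis hsub
    obtain ⟨F, hF, hFfin, hFdis, hFG, hmin⟩ :=
      exists_minimal_trace 𝓔 Y R hG hGfin (hGdis.mono_right (subset_insert _ _))
    obtain ⟨x, hx⟩ := h.diff_nonempty hF hFdis
    exact hA ⟨F, hF, hFfin, hFdis,
      ⟨x, (hsub (hFG hx).1).resolve_left hx.2, hx⟩, hmin⟩
  · intro E hE hinf hEθ hEdis
    by_contra hcon
    push Not at hcon
    exact hB ⟨E, hE, hinf, hEθ, hEdis, hcon⟩

/-! ### Counting and closure in almost disjoint families -/

/-- The edges with at least `r` points in `M` are determined by `r`-subsets of `M`. -/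
theorem mk_setOf_le_encard_inter_le {𝓔 : Set (Set V)} {r : ℕ} (hr : AlmostDisjoint 𝓔 r)
    {κ : Cardinal.{u}} (hκ : ℵ₀ ≤ κ) {M : Set V} (hM : #M ≤ κ) :
    #{E | E ∈ 𝓔 ∧ r ≤ (E ∩ M).encard} ≤ κ := by
  classical
  have hex : ∀ E : {E | E ∈ 𝓔 ∧ r ≤ (E ∩ M).encard}, ∃ s : Finset M,
      (s.map (Function.Embedding.subtype _) : Set V) ⊆ E ∧ s.card = r := by
    rintro ⟨E, hE, hrE⟩
    obtain ⟨t, htE, htr⟩ := Set.exists_subset_encard_eq hrE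
    have htfin : t.Finite := Set.finite_of_encard_eq_coe htr
    have htM : ∀ x ∈ htfin.toFinset, x ∈ M := fun x hx => (htE (by simpa using hx)).2
    refine ⟨htfin.toFinset.subtype (· ∈ M), ?_, ?_⟩
    · intro x hx
      simp only [Finset.coe_map, Function.Embedding.coe_subtype, Set.mem_image,
        Finset.mem_coe, Finset.mem_subtype, Set.Finite.mem_toFinset] at hx
      obtain ⟨a, ha, rfl⟩ := hx
      exact (htE ha).1
    · rw [Finset.card_subtype, Finset.filter_true_of_mem htM]
      rw [htfin.encard_eq_coe_toFinset_card] at htr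
      exact_mod_cast htr
  choose f hf hcard using hex
  have hinj : Function.Injective f := by
    rintro E E' hEE'
    by_contra hne
    have hlt := hr E E.2.1 E' E'.2.1 (fun h => hne (Subtype.ext h))
    have hsub : ((f E).map (Function.Embedding.subtype _) : Set V) ⊆ E.1 ∩ E'.1 :=
      subset_inter (hf E) (hEE' ▸ hf E')
    have := (Set.encard_le_encard hsub).trans_lt hlt
    rw [Set.encard_coe_eq_coe_finsetCard, Finset.card_map, hcard] at this
    exact this.false
  refine (mk_le_of_injective hinj).trans ?_
  rcases finite_or_infinite M with hfin | hinf
  · exact (Cardinal.mk_lt_aleph0 (α := Finset M)).le.trans hκ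
  · rw [Cardinal.mk_finset_of_infinite]
    exact hM

/-- An almost disjoint family on an infinite set is not larger than that set. -/
theorem mk_le_of_almostDisjoint {𝓔 : Set (Set V)} {r : ℕ} (hr : AlmostDisjoint 𝓔 r)
    {κ : Cardinal.{u}} (hκ : ℵ₀ ≤ κ) {X : Set V} (hX : #X ≤ κ) (hsub : ∀ E ∈ 𝓔, E ⊆ X) :
    #𝓔 ≤ κ := by
  classical
  have h1 : #{E | E ∈ 𝓔 ∧ E.Finite} ≤ κ := by
    have hex : ∀ E : {E | E ∈ 𝓔 ∧ E.Finite}, ∃ s : Finset X,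
        (s.map (Function.Embedding.subtype _) : Set V) = E := by
      rintro ⟨E, hE, hfin⟩
      refine ⟨hfin.toFinset.subtype (· ∈ X), ?_⟩
      ext x
      have := hsub E hE
      simp only [Finset.coe_map, Function.Embedding.coe_subtype, Set.mem_image,
        Finset.mem_coe, Finset.mem_subtype, Set.Finite.mem_toFinset]
      exact ⟨by rintro ⟨a, ha, rfl⟩; exact ha, fun hx => ⟨⟨x, this hx⟩, hx, rfl⟩⟩
    choose f hf using hex
    have hinj : Function.Injective f := fun E E' h => Subtype.ext (by rw [← hf, ← hf, h])
    refine (mk_le_of_injective hinj).trans ?_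
    rcases finite_or_infinite X with hfin | hinf
    · exact (Cardinal.mk_lt_aleph0 (α := Finset X)).le.trans hκ
    · rw [Cardinal.mk_finset_of_infinite]
      exact hX
  have h2 := mk_setOf_le_encard_inter_le hr hκ hX
  have hcov : 𝓔 ⊆ {E | E ∈ 𝓔 ∧ E.Finite} ∪ {E | E ∈ 𝓔 ∧ r ≤ (E ∩ X).encard} := by
    intro E hE
    by_cases hfin : E.Finite
    · exact Or.inl ⟨hE, hfin⟩
    · refine Or.inr ⟨hE, ?_⟩
      rw [inter_eq_left.2 (hsub E hE), Set.Infinite.encard_eq hfin]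
      exact le_top
  calc #𝓔 ≤ _ := mk_le_mk_of_subset hcov
    _ ≤ _ := mk_union_le _ _
    _ ≤ κ + κ := add_le_add h1 h2
    _ = κ := add_eq_self hκ

theorem mk_sUnion_le_of_le {κ : Cardinal.{u}} (hκ : ℵ₀ ≤ κ) {𝓕 : Set (Set V)} (h𝓕 : #𝓕 ≤ κ)
    (h : ∀ E ∈ 𝓕, #E ≤ κ) : #(⋃₀ 𝓕 : Set V) ≤ κ := by
  refine (mk_sUnion_le 𝓕).trans ?_
  refine (mul_le_mul' h𝓕 (ciSup_le' fun E : 𝓕 => h E.1 E.2)).trans ?_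
  rw [mul_eq_self hκ]

/-- Finite parts of a directed union. -/
theorem exists_le_encard_inter {ι : Type*} [Preorder ι] [IsDirectedOrder ι] {M : ι → Set V}
    (hM : Monotone M) (j : ι) {E : Set V} {r : ℕ} (hr : r ≤ (E ∩ ⋃ i, M i).encard) :
    ∃ i, j ≤ i ∧ r ≤ (E ∩ M i).encard := by
  obtain ⟨t, htE, htr⟩ := Set.exists_subset_encard_eq hr
  have htfin : t.Finite := Set.finite_of_encard_eq_coe htr
  have : Nonempty ι := ⟨j⟩
  have htM : (htfin.toFinset : Set V) ⊆ ⋃ i, M i := by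
    rw [htfin.coe_toFinset]
    exact fun x hx => (htE hx).2
  obtain ⟨i, hi⟩ := hM.directed_le.exists_mem_subset_of_finset_subset_biUnion htM
  obtain ⟨k, hjk, hik⟩ := exists_ge_ge j i
  refine ⟨k, hjk, htr ▸ Set.encard_le_encard fun x hx => ⟨(htE hx).1, hM hik ?_⟩⟩
  exact hi (by simpa using hx)

/-- Every set of size at most `κ` is contained in one of size at most `κ` that contains every edge
of size at most `κ` which it meets in at least `r` points. -/
theorem exists_closed_superset {𝓔 : Set (Set V)} {r : ℕ} (hr : AlmostDisjoint 𝓔 r)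
    {κ : Cardinal.{u}} (hκ : ℵ₀ ≤ κ) {M₀ : Set V} (hM₀ : #M₀ ≤ κ) :
    ∃ M, M₀ ⊆ M ∧ #M ≤ κ ∧ ∀ E ∈ 𝓔, #E ≤ κ → r ≤ (E ∩ M).encard → E ⊆ M := by
  let step : Set V → Set V := fun M => M ∪ ⋃₀ {E | E ∈ 𝓔 ∧ #E ≤ κ ∧ r ≤ (E ∩ M).encard}
  -- As `r` is finite, `r` points of the union lie in one `M n`, so `ω` steps suffice.
  let M : ℕ → Set V := fun n => step^[n] M₀
  have hsucc : ∀ n, M (n + 1) = step (M n) := fun n => Function.iterate_succ_apply' _ _ _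
  have hmono : Monotone M := monotone_nat_of_le_succ fun n => by
    rw [hsucc]; exact subset_union_left
  have hcard : ∀ n, #(M n) ≤ κ := by
    intro n
    induction n with
    | zero => exact hM₀
    | succ n ih =>
      rw [hsucc]
      refine (mk_union_le _ _).trans ?_
      refine (add_le_add ih (mk_sUnion_le_of_le hκ ?_ fun E hE => hE.2.1)).trans
        (add_eq_self hκ).le
      refine (mk_le_mk_of_subset ?_).trans (mk_setOf_le_encard_inter_le hr hκ ih)
      exact fun E hE => ⟨hE.1, hE.2.2⟩
  refine ⟨⋃ n, M n, subset_iUnion M 0, ?_, ?_⟩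
  · rw [← sUnion_range]
    refine mk_sUnion_le_of_le hκ (le_trans ?_ hκ) (by rintro _ ⟨n, rfl⟩; exact hcard n)
    exact (Set.countable_range M).le_aleph0
  · intro E hE hEκ hrE
    obtain ⟨n, -, hn⟩ := exists_le_encard_inter hmono 0 hrE
    refine Subset.trans ?_ (subset_iUnion M (n + 1))
    rw [hsucc]
    exact fun x hx => Or.inr ⟨E, ⟨hE, hEκ, hn⟩, hx⟩

/-! ### Meeting the small edges around the core -/

/-- Partial covers can be extended so that all edges of size less than `θ` with at least `r` points
in a suitable set of size less than `θ` are met. -/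
def Extendable (𝓔 : Set (Set V)) (r : ℕ) (θ : Cardinal.{u}) : Prop :=
  ∀ Y T M₀ : Set V, IsPartialCover 𝓔 Y T → M₀ ⊆ T → #M₀ < θ →
    ∃ Y' M', Y ⊆ Y' ∧ Y' ∩ T ⊆ Y ∧ M₀ ⊆ M' ∧ #M' < θ ∧ IsPartialCover 𝓔 Y' (T ∪ M') ∧
      ∀ E ∈ 𝓔, E.Infinite → #E < θ → r ≤ (E ∩ M').encard → ¬ Disjoint E Y'

/-- No infinite edge has size below `ℵ₀`, so there is nothing to meet. -/
theorem extendable_aleph0 (𝓔 : Set (Set V)) (r : ℕ) : Extendable 𝓔 r ℵ₀ := by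
  intro Y T M₀ h hM₀ hcard
  refine ⟨Y, M₀, subset_rfl, inter_subset_left, subset_rfl, hcard, ?_, ?_⟩
  · rwa [union_eq_left.2 hM₀]
  · intro E _ hinf hlt
    exact absurd (lt_aleph0_iff_set_finite.1 hlt) hinf

/-- If almost disjoint families on sets of size at most `κ` have minimal covers, then partial
covers can be extended with respect to edges of size at most `κ`. -/
theorem extendable_succ {𝓔 : Set (Set V)} {r : ℕ} (hr : AlmostDisjoint 𝓔 r)
    {S : Set Cardinal.{u}} (hS : ∀ E ∈ 𝓔, E.Infinite → #E ∈ S) {κ : Cardinal.{u}} (hκ : ℵ₀ ≤ κ)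
    (ih : ∀ (X : Set V) (𝓗 : Set (Set V)), #X ≤ κ → (∀ E ∈ 𝓗, E ⊆ X) → (∀ E ∈ 𝓗, E.Nonempty) →
      (∀ E ∈ 𝓗, E.Infinite → #E ∈ S) → AlmostDisjoint 𝓗 r → ∃ Z, IsPrivateCover 𝓗 Z) :
    Extendable 𝓔 r (Order.succ κ) := by
  intro Y T M₀ h hM₀ hcard
  obtain ⟨M, hM₀M, hMκ, hclosed⟩ := exists_closed_superset hr hκ (Order.lt_succ_iff.1 hcard)
  -- Infinite edges are admitted only with a small trace on `T`, so that `E \ T` keeps the size of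
  -- `E`, a member of `S`. The others contain a finite trace and are met through it.
  let A : Set (Set V) := {E | E ∈ 𝓔 ∧ Disjoint E Y ∧ E \ T ⊆ M ∧
    (E.Infinite → #(E ∩ T : Set V) < #E)}
  let 𝓗 : Set (Set V) := (fun E => E \ T) '' A
  have hdiff : ∀ E : Set V, E.Infinite → #(E ∩ T : Set V) < #E → #(E \ T : Set V) = #E := by
    intro E hinf hlt
    have hsum : #(E ∩ T : Set V) + #(E \ T : Set V) = #E := by
      have hd : Disjoint (E ∩ T) (E \ T) := disjoint_inf_sdiff
      rw [← mk_union_of_disjoint hd, inter_union_sdiff]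
    refine le_antisymm (mk_le_mk_of_subset sdiff_subset) (not_lt.1 fun hlt' => ?_)
    exact (add_lt_of_lt (Cardinal.aleph0_le_mk_iff.2 hinf.to_subtype) hlt hlt').ne hsum
  obtain ⟨Z, hZcov, hZpriv⟩ := ih (M \ T) 𝓗
    ((mk_le_mk_of_subset sdiff_subset).trans hMκ)
    (by rintro _ ⟨E, hE, rfl⟩; exact fun x hx => ⟨hE.2.2.1 hx, hx.2⟩)
    (by rintro _ ⟨E, hE, rfl⟩; exact h.diff_nonempty hE.1 hE.2.1)
    (by
      rintro _ ⟨E, hE, rfl⟩ hinf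
      have hEinf : E.Infinite := hinf.mono sdiff_subset
      dsimp only
      rw [hdiff E hEinf (hE.2.2.2 hEinf)]
      exact hS E hE.1 hEinf)
    (by
      rintro _ ⟨E, hE, rfl⟩ _ ⟨E', hE', rfl⟩ hne
      refine (Set.encard_le_encard (inter_subset_inter sdiff_subset sdiff_subset)).trans_lt
        (hr E hE.1 E' hE'.1 ?_)
      rintro rfl
      exact hne rfl)
  have hZsub : Z ⊆ M \ T := by
    intro z hz
    obtain ⟨_, ⟨E, hE, rfl⟩, hZE⟩ := hZpriv z hz
    have hzE : z ∈ Z ∩ (E \ T) := by rw [hZE]; rfl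
    exact ⟨hE.2.2.1 hzE.2, hzE.2.2⟩
  have hhit : ∀ E ∈ A, ∃ z ∈ Z, z ∈ E \ T := fun E hE => hZcov _ ⟨E, hE, rfl⟩
  have hYT : (Y ∪ Z) ∩ T ⊆ Y := by
    rintro x ⟨hx | hx, hxT⟩
    · exact hx
    · exact absurd hxT (hZsub hx).2
  have hmeet : ∀ E ∈ 𝓔, E.Infinite → #E < Order.succ κ → r ≤ (E ∩ M).encard →
      ¬ Disjoint E (Y ∪ Z) := by
    intro E hE hinf hEκ hrE hdis
    have hEM := hclosed E hE (Order.lt_succ_iff.1 hEκ) hrE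
    have hEY : Disjoint E Y := hdis.mono_right subset_union_left
    rcases h.infinite_trace E hE hinf hEY with hlt | ⟨F, hF, hFfin, hFdis, hFsub⟩
    · obtain ⟨z, hz, hzE⟩ := hhit E ⟨hE, hEY, sdiff_subset.trans hEM, fun _ => hlt⟩
      exact Set.disjoint_left.1 hdis hzE.1 (Or.inr hz)
    · obtain ⟨z, hz, hzF⟩ := hhit F ⟨hF, hFdis, hFsub.trans hEM, fun hi => absurd hFfin hi⟩
      exact Set.disjoint_left.1 hdis (hFsub hzF) (Or.inr hz)
  refine ⟨Y ∪ Z, M, subset_union_left, hYT, hM₀M, Order.lt_succ_iff.2 hMκ, ⟨?_, ?_, ?_, ?_⟩,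
    hmeet⟩
  · exact union_subset (h.subset.trans subset_union_left)
      (hZsub.trans (sdiff_subset.trans subset_union_right))
  · rintro y (hy | hy)
    · obtain ⟨E, hE, hET, hYE⟩ := h.exists_private y hy
      refine ⟨E, hE, hET.trans subset_union_left, ?_⟩
      rw [← hYE]
      exact Subset.antisymm (fun x hx => ⟨hYT ⟨hx.1, hET hx.2⟩, hx.2⟩)
        (inter_subset_inter_left _ subset_union_left)
    · obtain ⟨_, ⟨E, hE, rfl⟩, hZE⟩ := hZpriv y hy
      refine ⟨E, hE.1, fun x hx => ?_, ?_⟩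
      · by_cases hxT : x ∈ T
        · exact Or.inl hxT
        · exact Or.inr (hE.2.2.1 ⟨hx, hxT⟩)
      · rw [← hZE, union_inter_distrib_right, hE.2.1.symm.inter_eq, empty_union]
        exact Subset.antisymm (fun x hx => ⟨hx.1, hx.2, (hZsub hx.1).2⟩)
          (inter_subset_inter_right _ sdiff_subset)
  · intro E hE hfin hdis hsub
    obtain ⟨z, hz, hzE⟩ := hhit E ⟨hE, hdis.mono_right subset_union_left,
      fun x hx => (hsub hx.1).resolve_left hx.2, fun hi => absurd hfin hi⟩
    exact Set.disjoint_left.1 hdis hzE.1 (Or.inr hz)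
  · intro E hE hinf hdis
    rcases h.infinite_trace E hE hinf (hdis.mono_right subset_union_left) with hlt | halt
    · left
      -- A small unmet edge has fewer than `r` points in `M` by `hmeet`; a larger one outweighs `M`.
      by_cases hEκ : #E ≤ κ
      · refine mk_inter_union_finite_lt hinf hlt ?_
        have : (E ∩ M).encard < r := not_le.1 fun hle =>
          hmeet E hE hinf (Order.lt_succ_iff.2 hEκ) hle hdis
        exact Set.encard_lt_top_iff.1 (this.trans_le le_top)
      · rw [inter_union_distrib_left]
        refine (mk_union_le _ _).trans_lt (add_lt_of_lt
          (Cardinal.aleph0_le_mk_iff.2 hinf.to_subtype) hlt ?_)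
        exact ((mk_le_mk_of_subset inter_subset_right).trans hMκ).trans_lt (not_le.1 hEκ)
    · exact Or.inr (halt.mono subset_union_left hYT hdis)

/-! ### Stages and the successor step -/

/-- A stage of the construction of a minimal cover: the chosen points, the points that are decided,
and a decomposition of the latter into a small set and the union of few edges. -/
structure Stage (V : Type u) where
  /-- The chosen points. -/
  chosen : Set V
  /-- The points of which no further one will be chosen. -/
  decided : Set V
  /-- The small part of the decided points. -/
  core : Set V
  /-- The edges which, together with the core, make up the decided points. -/
  large : Set (Set V)

/-- The properties of a stage that hold at limits of the construction, too. -/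
structure Stage.IsGood (𝓔 : Set (Set V)) (θ : Cardinal.{u}) (s : Stage V) : Prop where
  partialCover : IsPartialCover 𝓔 s.chosen s.decided
  decided_eq : s.decided = s.core ∪ ⋃₀ s.large
  large_subset : s.large ⊆ 𝓔
  large_meets : ∀ E ∈ s.large, ¬ Disjoint E s.chosen
  core_lt : #s.core < θ
  large_lt : #s.large < θ

/-- All small infinite edges with at least `r` points in the core have been met. -/
def Stage.MeetsCore (𝓔 : Set (Set V)) (r : ℕ) (θ : Cardinal.{u}) (s : Stage V) : Prop :=
  ∀ E ∈ 𝓔, E.Infinite → #E < θ → r ≤ (E ∩ s.core).encard → ¬ Disjoint E s.chosen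

/-- The stage `t` continues the stage `s`, with new decided points of small edges in the core. -/
structure Stage.Extends (𝓔 : Set (Set V)) (θ : Cardinal.{u}) (s t : Stage V) : Prop where
  chosen_subset : s.chosen ⊆ t.chosen
  decided_subset : s.decided ⊆ t.decided
  core_subset : s.core ⊆ t.core
  large_subset : s.large ⊆ t.large
  chosen_inter : t.chosen ∩ s.decided ⊆ s.chosen
  inter_decided : ∀ E ∈ 𝓔, E.Infinite → #E < θ → Disjoint E t.chosen →
    E ∩ t.decided ⊆ s.decided ∪ t.core ∨ ContainsFiniteTrace 𝓔 t.chosen t.decided E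

theorem Stage.Extends.refl (𝓔 : Set (Set V)) (θ : Cardinal.{u}) (s : Stage V) :
    s.Extends 𝓔 θ s :=
  ⟨subset_rfl, subset_rfl, subset_rfl, subset_rfl, inter_subset_left,
    fun _ _ _ _ _ => Or.inl (inter_subset_right.trans subset_union_left)⟩

theorem Stage.Extends.trans {𝓔 : Set (Set V)} {θ θ' : Cardinal.{u}} {s t w : Stage V}
    (h : s.Extends 𝓔 θ t) (h' : t.Extends 𝓔 θ' w) (hθ : θ ≤ θ') : s.Extends 𝓔 θ w := by
  refine ⟨h.chosen_subset.trans h'.chosen_subset, h.decided_subset.trans h'.decided_subset,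
    h.core_subset.trans h'.core_subset, h.large_subset.trans h'.large_subset, ?_, ?_⟩
  · exact fun x hx => h.chosen_inter ⟨h'.chosen_inter ⟨hx.1, h.decided_subset hx.2⟩, hx.2⟩
  · intro E hE hinf hEθ hdis
    rcases h'.inter_decided E hE hinf (hEθ.trans_le hθ) hdis with h1 | h1
    · rcases h.inter_decided E hE hinf hEθ (hdis.mono_right h'.chosen_subset) with h2 | h2
      · left
        intro x hx
        rcases h1 hx with hxt | hxw
        · rcases h2 ⟨hx.1, hxt⟩ with hxs | hxt
          · exact Or.inl hxs
          · exact Or.inr (h'.core_subset hxt)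
        · exact Or.inr hxw
      · exact Or.inr (h2.mono h'.decided_subset h'.chosen_inter hdis)
    · exact Or.inr h1

/-- One step of the construction: an edge `L` is met. -/
theorem Stage.IsGood.exists_extends {𝓔 : Set (Set V)} {r : ℕ} (hr : AlmostDisjoint 𝓔 r)
    {θ : Cardinal.{u}} (hθ : ℵ₀ ≤ θ) (hext : Extendable 𝓔 r θ) {s : Stage V}
    (hs : s.IsGood 𝓔 θ) {L : Set V} (hL : L ∈ 𝓔) :
    ∃ t : Stage V, t.IsGood 𝓔 θ ∧ t.MeetsCore 𝓔 r θ ∧ s.Extends 𝓔 θ t ∧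
      ¬ Disjoint L t.chosen := by
  have hmid : ∃ t : Stage V, t.IsGood 𝓔 θ ∧ s.Extends 𝓔 θ t ∧ ¬ Disjoint L t.chosen := by
    by_cases hdis : Disjoint L s.chosen
    swap
    · exact ⟨s, hs, .refl _ _ _, hdis⟩
    obtain ⟨y, hyL, F, hF, hyR, hyF, hpc, hsmall⟩ := hs.partialCover.exists_insert hr hL hdis hθ
    have hchosen : insert y s.chosen ∩ s.decided ⊆ s.chosen := by
      rintro x ⟨rfl | hx, hxR⟩
      · exact absurd hxR hyR
      · exact hx
    have hLy : ¬ Disjoint L (insert y s.chosen) :=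
      Set.not_disjoint_iff.2 ⟨y, hyL, mem_insert _ _⟩
    -- A small private edge is absorbed into the core; otherwise it joins the large edges, and
    -- `hsmall` says that it adds nothing to unprotected small edges.
    by_cases hFθ : #F < θ
    · refine ⟨⟨insert y s.chosen, s.decided ∪ F, s.core ∪ F, s.large⟩,
        ⟨hpc, ?_, hs.large_subset, ?_, ?_, hs.large_lt⟩,
        ⟨subset_insert _ _, subset_union_left, subset_union_left, subset_rfl, hchosen, ?_⟩, hLy⟩
      · dsimp only
        rw [hs.decided_eq]
        ac_rfl
      · exact fun E hE h => hs.large_meets E hE (h.mono_right (subset_insert _ _))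
      · exact (mk_union_le _ _).trans_lt (add_lt_of_lt hθ hs.core_lt hFθ)
      · intro E _ _ _ _
        left
        rintro x ⟨_, hx | hx⟩
        · exact Or.inl hx
        · exact Or.inr (Or.inr hx)
    · refine ⟨⟨insert y s.chosen, s.decided ∪ F, s.core, insert F s.large⟩,
        ⟨hpc, ?_, insert_subset hF hs.large_subset, ?_, hs.core_lt, ?_⟩,
        ⟨subset_insert _ _, subset_union_left, subset_rfl, subset_insert _ _, hchosen, ?_⟩, hLy⟩
      · dsimp only
        rw [hs.decided_eq, sUnion_insert]
        ac_rfl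
      · rintro E (rfl | hE) h
        · exact Set.disjoint_left.1 h hyF (mem_insert _ _)
        · exact hs.large_meets E hE (h.mono_right (subset_insert _ _))
      · exact (mk_insert_le).trans_lt
          (add_lt_of_lt hθ hs.large_lt (one_lt_aleph0.trans_le hθ))
      · intro E hE hinf hEθ hEdis
        rcases (hsmall.resolve_left hFθ) E hE hinf hEθ
          (hEdis.mono_right (subset_insert _ _)) with h | h
        · left
          rintro x ⟨hxE, hx | hx⟩
          · exact Or.inl hx
          · exact Or.inl (h ⟨hxE, hx⟩)
        · exact Or.inr (h.mono subset_union_left hchosen hEdis)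
  obtain ⟨t, ht, hst, hLt⟩ := hmid
  have hcore : t.core ⊆ t.decided := by rw [ht.decided_eq]; exact subset_union_left
  -- The core may have grown; `hext` enlarges it further so that `MeetsCore` holds.
  obtain ⟨Y, M, hY, hYt, hM, hMθ, hpc, hmeets⟩ := hext _ _ _ ht.partialCover hcore ht.core_lt
  refine ⟨⟨Y, t.decided ∪ M, M, t.large⟩,
    ⟨hpc, ?_, ht.large_subset, ?_, hMθ, ht.large_lt⟩, hmeets,
    hst.trans ⟨hY, subset_union_left, hM, subset_rfl, hYt, ?_⟩ le_rfl, ?_⟩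
  · dsimp only
    rw [ht.decided_eq]
    ext x
    simp only [mem_union]
    have := @hM x
    tauto
  · exact fun E hE h => ht.large_meets E hE (h.mono_right hY)
  · exact fun E _ _ _ _ => Or.inl inter_subset_right
  · exact fun h => hLt (h.mono_right hY)

/-! ### Limits of stages -/

/-- The union of a family of stages. -/
def Stage.iUnion {ι : Type*} (f : ι → Stage V) : Stage V :=
  ⟨⋃ i, (f i).chosen, ⋃ i, (f i).decided, ⋃ i, (f i).core, ⋃ i, (f i).large⟩

theorem mk_inter_sUnion_lt {𝓔 : Set (Set V)} {r : ℕ} (hr : AlmostDisjoint 𝓔 r) {E : Set V}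
    (hE : E ∈ 𝓔) (hinf : E.Infinite) {𝓛 : Set (Set V)} (h𝓛 : 𝓛 ⊆ 𝓔) (hEL : E ∉ 𝓛)
    (hlt : #𝓛 < #E) : #(E ∩ ⋃₀ 𝓛 : Set V) < #E := by
  have hfin : ∀ L ∈ 𝓛, (E ∩ L).Finite := fun L hL =>
    hr.finite_inter hE (h𝓛 hL) fun h => hEL (h ▸ hL)
  have heq : E ∩ ⋃₀ 𝓛 = ⋃₀ ((fun L => E ∩ L) '' 𝓛) := by
    rw [sUnion_image, sUnion_eq_biUnion, inter_iUnion₂]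
  have hEinf : ℵ₀ ≤ #E := Cardinal.aleph0_le_mk_iff.2 hinf.to_subtype
  rw [heq]
  by_cases h𝓛fin : 𝓛.Finite
  · refine (lt_aleph0_iff_set_finite.2 ?_).trans_le hEinf
    exact Set.Finite.sUnion (h𝓛fin.image _) (by rintro _ ⟨L, hL, rfl⟩; exact hfin L hL)
  · have hinf𝓛 : ℵ₀ ≤ #𝓛 :=
      Cardinal.aleph0_le_mk_iff.2 (Set.Infinite.to_subtype h𝓛fin)
    refine (mk_sUnion_le_of_le hinf𝓛 mk_image_le ?_).trans_lt hlt
    rintro _ ⟨L, hL, rfl⟩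
    exact (lt_aleph0_iff_set_finite.2 (hfin L hL)).le.trans hinf𝓛

section Chain

variable {ι : Type*} [LinearOrder ι] {𝓔 : Set (Set V)} {r : ℕ} {θ : ι → Cardinal.{u}}
  {f : ι → Stage V}

/-- Each point of `E` in the union is decided at some stage, whose `inter_decided` accounts for it;
a finite trace found there would persist to the union. -/
theorem Stage.extends_iUnion
    (hf : ∀ i j, i < j → (f i).Extends 𝓔 (θ i) (f j)) (i : ι) :
    (f i).Extends 𝓔 (θ i) (Stage.iUnion f) := by
  have hf' : ∀ i j, i ≤ j → (f i).Extends 𝓔 (θ i) (f j) := by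
    intro i j hij
    rcases hij.eq_or_lt with rfl | hlt
    · exact .refl _ _ _
    · exact hf i j hlt
  have hinter : ∀ j, (Stage.iUnion f).chosen ∩ (f j).decided ⊆ (f j).chosen := by
    rintro j x ⟨hx, hxR⟩
    obtain ⟨k, hk⟩ := mem_iUnion.1 hx
    rcases le_total k j with hkj | hjk
    · exact (hf' k j hkj).chosen_subset hk
    · exact (hf' j k hjk).chosen_inter ⟨hk, hxR⟩
  refine ⟨subset_iUnion (fun j => (f j).chosen) i, subset_iUnion (fun j => (f j).decided) i,
    subset_iUnion (fun j => (f j).core) i, subset_iUnion (fun j => (f j).large) i, hinter i, ?_⟩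
  intro E hE hinf hEθ hdis
  by_contra hcon
  push Not at hcon
  obtain ⟨hns, hnalt⟩ := hcon
  refine hns ?_
  rintro x ⟨hxE, hx⟩
  obtain ⟨k, hk⟩ := mem_iUnion.1 hx
  rcases le_total k i with hki | hik
  · exact Or.inl ((hf' k i hki).decided_subset hk)
  · rcases (hf' i k hik).inter_decided E hE hinf hEθ
      (hdis.mono_right (subset_iUnion (fun j => (f j).chosen) k)) with h | h
    · exact (h ⟨hxE, hk⟩).imp id fun hx => mem_iUnion.2 ⟨k, hx⟩
    · exact absurd (h.mono (subset_iUnion (fun j => (f j).decided) k) (hinter k) hdis) hnalt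

/-- The union of a chain of stages is a partial cover. -/
theorem Stage.isPartialCover_iUnion (hr : AlmostDisjoint 𝓔 r) (hne : ∀ E ∈ 𝓔, E.Nonempty)
    (hθ : Monotone θ) (hf : ∀ i j, i < j → (f i).Extends 𝓔 (θ i) (f j))
    (hgood : ∀ i, (f i).IsGood 𝓔 (θ i)) (hmeets : ∀ i, (f i).MeetsCore 𝓔 r (θ i))
    (hgap : ∀ E ∈ 𝓔, E.Infinite → (∀ i, θ i ≤ #E) →
      #(Stage.iUnion f).core < #E ∧ #(Stage.iUnion f).large < #E) :
    IsPartialCover 𝓔 (Stage.iUnion f).chosen (Stage.iUnion f).decided := by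
  have hU := Stage.extends_iUnion hf
  have hdecided : Monotone fun i => (f i).decided := by
    intro i j hij
    rcases hij.eq_or_lt with rfl | hlt
    · exact subset_rfl
    · exact (hf i j hlt).decided_subset
  have hcore : Monotone fun i => (f i).core := by
    intro i j hij
    rcases hij.eq_or_lt with rfl | hlt
    · exact subset_rfl
    · exact (hf i j hlt).core_subset
  refine ⟨iUnion_mono fun i => (hgood i).partialCover.subset, ?_, ?_, ?_⟩
  · intro y hy
    obtain ⟨i, hi⟩ := mem_iUnion.1 hy
    obtain ⟨E, hE, hER, hYE⟩ := (hgood i).partialCover.exists_private y hi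
    refine ⟨E, hE, hER.trans (hU i).decided_subset, ?_⟩
    rw [← hYE]
    exact Subset.antisymm (fun x hx => ⟨(hU i).chosen_inter ⟨hx.1, hER hx.2⟩, hx.2⟩)
      (inter_subset_inter_left _ (hU i).chosen_subset)
  · intro E hE hfin hdis hsub
    obtain ⟨x, hx⟩ := hne E hE
    obtain ⟨i₀, -⟩ := mem_iUnion.1 (hsub hx)
    have : Nonempty ι := ⟨i₀⟩
    have hsub' : (hfin.toFinset : Set V) ⊆ ⋃ i, (f i).decided := by
      rw [hfin.coe_toFinset]
      exact hsub
    obtain ⟨i, hi⟩ := hdecided.directed_le.exists_mem_subset_of_finset_subset_biUnion hsub'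
    rw [hfin.coe_toFinset] at hi
    exact (hgood i).partialCover.finite_not_subset E hE hfin
      (hdis.mono_right (hU i).chosen_subset) hi
  · intro E hE hinf hdis
    -- An edge above all bounds outweighs the core and the number of large edges, by `hgap`.
    by_cases hsmall : ∀ i, θ i ≤ #E
    · left
      obtain ⟨h1, h2⟩ := hgap E hE hinf hsmall
      have hsub : E ∩ (Stage.iUnion f).decided ⊆
          (Stage.iUnion f).core ∪ (E ∩ ⋃₀ (Stage.iUnion f).large) := by
        rintro x ⟨hxE, hx⟩
        obtain ⟨i, hi⟩ := mem_iUnion.1 hx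
        rw [(hgood i).decided_eq] at hi
        rcases hi with hi | ⟨L, hL, hxL⟩
        · exact Or.inl ((hU i).core_subset hi)
        · exact Or.inr ⟨hxE, L, (hU i).large_subset hL, hxL⟩
      refine (mk_le_mk_of_subset hsub).trans_lt ((mk_union_le _ _).trans_lt (add_lt_of_lt
        (Cardinal.aleph0_le_mk_iff.2 hinf.to_subtype) h1 ?_))
      refine mk_inter_sUnion_lt hr hE hinf (iUnion_subset fun i => (hgood i).large_subset) ?_ h2
      intro hEL
      obtain ⟨i, hi⟩ := mem_iUnion.1 hEL
      exact (hgood i).large_meets E hi (hdis.mono_right (hU i).chosen_subset)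
    -- Beyond stage `i` a smaller unprotected edge gains only core points. Were there `r` of them,
    -- they would lie in the core of a single later stage, which would have met the edge.
    · push Not at hsmall
      obtain ⟨i, hi⟩ := hsmall
      rcases (hU i).inter_decided E hE hinf hi hdis with h1 | h1
      swap
      · exact Or.inr h1
      rcases (hgood i).partialCover.infinite_trace E hE hinf
        (hdis.mono_right (hU i).chosen_subset) with h2 | h2
      swap
      · exact Or.inr (h2.mono (hU i).decided_subset (hU i).chosen_inter hdis)
      left
      have hlt : (E ∩ (Stage.iUnion f).core).encard < r := by
        rw [← not_le]
        intro hle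
        obtain ⟨k, hik, hk⟩ := exists_le_encard_inter hcore i hle
        exact hmeets k E hE hinf (hi.trans_le (hθ hik)) hk
          (hdis.mono_right (hU k).chosen_subset)
      refine (mk_le_mk_of_subset ?_).trans_lt (mk_inter_union_finite_lt hinf h2
        (Set.encard_lt_top_iff.1 (hlt.trans_le le_top)))
      exact fun x hx => ⟨hx.1, h1 hx⟩

end Chain

/-! ### The transfinite construction -/

/-- Transfinite construction of a chain. -/
theorem exists_chain {ι : Type*} [LinearOrder ι] [WellFoundedLT ι] {σ : Type*}
    (P : ι → σ → Prop) (R : ι → σ → σ → Prop)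
    (H : ∀ i, ∀ f : Iio i → σ, (∀ j : Iio i, P j (f j)) → (∀ j k : Iio i, j < k → R j (f j) (f k)) →
      ∃ s, P i s ∧ ∀ j : Iio i, R j (f j) s) :
    ∃ f : ι → σ, (∀ i, P i (f i)) ∧ ∀ i j, i < j → R i (f i) (f j) := by
  classical
  by_cases hι : Nonempty ι
  swap
  · rw [not_nonempty_iff] at hι
    exact ⟨fun i => (hι.false i).elim, fun i => (hι.false i).elim, fun i => (hι.false i).elim⟩
  have hσ : Nonempty σ := by
    obtain ⟨i, -, hi⟩ := (wellFounded_lt (α := ι)).has_min Set.univ Set.univ_nonempty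
    have hemp : IsEmpty (Iio i) := ⟨fun j => hi j trivial j.2⟩
    obtain ⟨s, -⟩ := H i (fun j => hemp.elim j) (fun j => hemp.elim j) (fun j => hemp.elim j)
    exact ⟨s⟩
  let F : ∀ i : ι, (∀ j, j < i → σ) → σ := fun i g =>
    Classical.epsilon fun s => P i s ∧ ∀ j : Iio i, R j (g j j.2) s
  let f : ι → σ := (wellFounded_lt (α := ι)).fix F
  have hfix : ∀ i, f i = Classical.epsilon fun s => P i s ∧ ∀ j : Iio i, R j (f j) s :=
    fun i => (wellFounded_lt (α := ι)).fix_eq F i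
  have key : ∀ i, P i (f i) ∧ ∀ j : Iio i, R j (f j) (f i) := by
    intro i
    induction i using (wellFounded_lt (α := ι)).induction with
    | _ i ih =>
      have := H i (fun j => f j) (fun j => (ih j j.2).1)
        (fun j k hjk => (ih k k.2).2 ⟨j, hjk⟩)
      rw [hfix i]
      exact Classical.epsilon_spec this
  exact ⟨f, fun i => (key i).1, fun i j hij => (key j).2 ⟨i, hij⟩⟩

/-- The cardinals `θ i` bound the sizes in a construction of length `ι`, for edges whose infinite
sizes belong to `S`. -/
structure IsSizeBound {ι : Type u} [LinearOrder ι] (S : Set Cardinal.{u})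
    (θ : ι → Cardinal.{u}) : Prop where
  mono : Monotone θ
  aleph0_le : ∀ i, ℵ₀ ≤ θ i
  mk_iUnion_lt : ∀ (i : ι) (α : Type u) (X : Iio i → Set α), (∀ j, #(X j) < θ j) →
    #(⋃ j, X j) < θ i
  gap : ∀ (i : ι) (α : Type u) (X : Iio i → Set α), (∀ j, #(X j) < θ j) →
    ∀ μ ∈ S, ℵ₀ ≤ μ → (∀ j : Iio i, θ j ≤ μ) → #(⋃ j, X j) < μ

/-- The construction of a minimal cover from a suitable enumeration of the edges. -/
theorem exists_isPrivateCover_of_isSizeBound {𝓔 : Set (Set V)} {r : ℕ}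
    (hr : AlmostDisjoint 𝓔 r) (hne : ∀ E ∈ 𝓔, E.Nonempty) {S : Set Cardinal.{u}}
    (hS : ∀ E ∈ 𝓔, E.Infinite → #E ∈ S) {ι : Type u} [LinearOrder ι] [WellFoundedLT ι]
    {θ : ι → Cardinal.{u}} (hθ : IsSizeBound S θ) (hext : ∀ i, Extendable 𝓔 r (θ i))
    (e : ι ≃ 𝓔) : ∃ Y, IsPrivateCover 𝓔 Y := by
  obtain ⟨f, hf, hchain⟩ := exists_chain
    (fun i (s : Stage V) => s.IsGood 𝓔 (θ i) ∧ s.MeetsCore 𝓔 r (θ i) ∧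
      ¬ Disjoint (e i).1 s.chosen)
    (fun i s t => s.Extends 𝓔 (θ i) t) (by
      intro i f hf hchain
      have hmono : Monotone fun j : Iio i => θ j := fun j k hjk => hθ.mono hjk
      have hU := Stage.extends_iUnion hchain
      have hgood : (Stage.iUnion f).IsGood 𝓔 (θ i) := by
        refine ⟨Stage.isPartialCover_iUnion hr hne hmono hchain (fun j => (hf j).1)
          (fun j => (hf j).2.1) ?_, ?_, iUnion_subset fun j => (hf j).1.large_subset, ?_,
          hθ.mk_iUnion_lt i _ _ fun j => (hf j).1.core_lt,
          hθ.mk_iUnion_lt i _ _ fun j => (hf j).1.large_lt⟩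
        · intro E hE hinf hsmall
          have hEinf : ℵ₀ ≤ #E := Cardinal.aleph0_le_mk_iff.2 hinf.to_subtype
          exact ⟨hθ.gap i _ _ (fun j => (hf j).1.core_lt) _ (hS E hE hinf) hEinf hsmall,
            hθ.gap i _ _ (fun j => (hf j).1.large_lt) _ (hS E hE hinf) hEinf hsmall⟩
        · change (⋃ j, (f j).decided) = (⋃ j, (f j).core) ∪ ⋃₀ (⋃ j, (f j).large)
          rw [sUnion_iUnion, ← iUnion_union_distrib]
          exact iUnion_congr fun j => (hf j).1.decided_eq
        · intro E hE hdis
          obtain ⟨j, hj⟩ := mem_iUnion.1 hE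
          exact (hf j).1.large_meets E hj (hdis.mono_right (hU j).chosen_subset)
      obtain ⟨t, h1, h2, h3, h4⟩ :=
        hgood.exists_extends hr (hθ.aleph0_le i) (hext i) (e i).2
      exact ⟨t, ⟨h1, h2, h4⟩, fun j => (hU j).trans h3 (hθ.mono j.2.le)⟩)
  have hU := Stage.extends_iUnion hchain
  refine ⟨(Stage.iUnion f).chosen, fun E hE => ?_, fun y hy => ?_⟩
  · obtain ⟨i, hi⟩ := e.surjective ⟨E, hE⟩
    have h := (hf i).2.2
    rw [hi] at h
    obtain ⟨x, hxE, hx⟩ := Set.not_disjoint_iff.1 h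
    exact ⟨x, (hU i).chosen_subset hx, hxE⟩
  · obtain ⟨i, hi⟩ := mem_iUnion.1 hy
    obtain ⟨E, hE, hER, hYE⟩ := (hf i).1.partialCover.exists_private y hi
    refine ⟨E, hE, ?_⟩
    rw [← hYE]
    exact Subset.antisymm (fun x hx => ⟨(hU i).chosen_inter ⟨hx.1, hER hx.2⟩, hx.2⟩)
      (inter_subset_inter_left _ (hU i).chosen_subset)

/-! ### Choice of the sizes -/

theorem mk_iUnion_le_of_le {ι α : Type u} {κ : Cardinal.{u}} (hκ : ℵ₀ ≤ κ) (hι : #ι ≤ κ)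
    {X : ι → Set α} (h : ∀ i, #(X i) ≤ κ) : #(⋃ i, X i) ≤ κ := by
  rw [← sUnion_range]
  refine mk_sUnion_le_of_le hκ (mk_range_le.trans hι) ?_
  rintro _ ⟨i, rfl⟩
  exact h i

theorem exists_typein_eq {o a : Ordinal.{u}} (h : a < o) :
    ∃ j : o.ToType, Ordinal.typein (α := o.ToType) (· < ·) j = a :=
  Ordinal.typein_surj _ (by rwa [Ordinal.type_toType])

theorem mk_Iio_toType {o : Ordinal.{u}} (j : o.ToType) :
    #(Iio j) = (Ordinal.typein (α := o.ToType) (· < ·) j).card :=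
  rfl

theorem mk_Iio_lt_of_ord {c : Cardinal.{u}} (i : c.ord.ToType) : #(Iio i) < c := by
  rw [mk_Iio_toType, ← lt_ord]
  exact Ordinal.typein_lt_self i

/-- An initial segment all of whose proper initial segments have size less than `ν` has size at
most `ν`. -/
theorem mk_Iio_le_of_forall_lt {o : Ordinal.{u}} {ν : Cardinal.{u}} (i : o.ToType)
    (h : ∀ j < i, #(Iio j) < ν) : #(Iio i) ≤ ν := by
  by_contra! hlt
  have hi : ν.ord < Ordinal.typein (α := o.ToType) (· < ·) i :=
    (ord_lt_ord.2 hlt).trans_le (ord_card_le _)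
  obtain ⟨j, hj⟩ := exists_typein_eq (hi.trans (Ordinal.typein_lt_self i))
  rw [← hj, Ordinal.typein_lt_typein] at hi
  refine (h j hi).ne ?_
  rw [mk_Iio_toType, hj, card_ord]

theorem isSizeBound_aleph0 {ι : Type u} [LinearOrder ι] (S : Set Cardinal.{u})
    (hfin : ∀ i : ι, (Iio i).Finite) : IsSizeBound S fun _ : ι => ℵ₀ := by
  have key : ∀ (i : ι) (α : Type u) (X : Iio i → Set α), (∀ j, #(X j) < ℵ₀) →
      #(⋃ j, X j) < ℵ₀ := by
    intro i α X hX
    have : Finite (Iio i) := hfin i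
    exact lt_aleph0_iff_set_finite.2
      (Set.finite_iUnion fun j => lt_aleph0_iff_set_finite.1 (hX j))
  exact ⟨monotone_const, fun _ => le_rfl, key,
    fun i α X hX μ _ hμ _ => (key i α X hX).trans_le hμ⟩

/-- A size `μ` above all earlier `κ j` may still be at most `κ i`, so `hgap` asks for a uniform `ν <
μ`: a union of at most `ν` sets of size at most `ν` stays below `μ`. An index `j < i` ensures that
`ν` is infinite. -/
theorem isSizeBound_succ {ι : Type u} [LinearOrder ι] {S : Set Cardinal.{u}}
    {κ : ι → Cardinal.{u}} (hmono : Monotone κ) (hκ : ∀ i, ℵ₀ ≤ κ i) (hι : ∀ i, #(Iio i) ≤ κ i)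
    (hgap : ∀ i, ∀ μ ∈ S, (Iio i).Nonempty → (∀ j < i, κ j < μ) →
      ∃ ν < μ, #(Iio i) ≤ ν ∧ ∀ j < i, κ j ≤ ν) :
    IsSizeBound S fun i => Order.succ (κ i) := by
  refine ⟨fun i j hij => Order.succ_le_succ (hmono hij),
    fun i => (hκ i).trans (Order.le_succ _), ?_, ?_⟩
  · intro i α X hX
    refine Order.lt_succ_iff.2 (mk_iUnion_le_of_le (hκ i) (hι i) fun j => ?_)
    exact (Order.lt_succ_iff.1 (hX j)).trans (hmono j.2.le)
  · intro i α X hX μ hμS hμ hle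
    rcases (Iio i).eq_empty_or_nonempty with hemp | hne
    · have : IsEmpty (Iio i) := isEmpty_coe_sort.2 hemp
      rw [iUnion_of_empty, mk_eq_zero]
      exact aleph0_pos.trans_le hμ
    · obtain ⟨ν, hν, h1, h2⟩ := hgap i μ hμS hne fun j hj => Order.succ_le_iff.1 (hle ⟨j, hj⟩)
      obtain ⟨j, hj⟩ := hne
      refine (mk_iUnion_le_of_le ((hκ j).trans (h2 j hj)) h1 fun k => ?_).trans_lt hν
      exact (Order.lt_succ_iff.1 (hX k)).trans (h2 k k.2)

/-- Below an uncountable limit cardinal there is a cofinal set of cardinals whose limits avoid a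
given nowhere stationary set. -/
theorem exists_cofinal_avoiding {S : Set Cardinal.{u}} (hS : NowhereStationaryCardinals S)
    {lam : Cardinal.{u}} (hlam : ℵ₀ < lam) (hlim : ∀ c < lam, Order.succ c < lam) :
    ∃ C : Set Cardinal.{u}, (∀ c ∈ C, ℵ₀ ≤ c ∧ c < lam) ∧ (∀ c < lam, ∃ d ∈ C, c < d) ∧
      ∀ μ ∈ S, μ < lam → ∀ A ⊆ C, A.Nonempty → (∀ a ∈ A, a < μ) → ∃ ν < μ, ∀ a ∈ A, a ≤ ν := by
  by_cases hcof : ℵ₀ < lam.ord.cof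
  -- Uncountable cofinality: `C` consists of the infinite cardinals in a club `D` that misses `S`.
  · obtain ⟨D, hD, hdis⟩ := not_isStationary_iff.1 (hS lam.ord hcof)
    have hK : IsClub {x : Iio lam.ord | ∃ c : Cardinal.{u}, ℵ₀ ≤ c ∧ c.ord = x} := by
      constructor
      · rintro t ht ⟨a, ha⟩ - x hx
        obtain ⟨c, hc, hca⟩ := ht ha
        have hax : c.ord ≤ x.1 := hca ▸ hx.1 ha
        refine ⟨x.1.card, hc.trans (ord_le.1 hax), le_antisymm (ord_card_le _) ?_⟩
        have hlt : x.1.card.ord < lam.ord := (ord_card_le _).trans_lt x.2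
        have : x ≤ ⟨x.1.card.ord, hlt⟩ := hx.2 fun b hb => by
          obtain ⟨d, -, hdb⟩ := ht hb
          have hbx : b.1 ≤ x.1 := hx.1 hb
          rw [← hdb] at hbx
          change b.1 ≤ _
          rw [← hdb]
          exact ord_le_ord.2 (ord_le.1 hbx)
        exact this
      · intro x
        have hx : x.1.card < lam := lt_ord.1 x.2
        have hlt : max ℵ₀ (Order.succ x.1.card) < lam := max_lt hlam (hlim _ hx)
        refine ⟨⟨_, ord_lt_ord.2 hlt⟩, ⟨_, le_max_left _ _, rfl⟩, ?_⟩
        change x.1 ≤ _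
        exact (lt_ord.2 ((Order.lt_succ _).trans_le (le_max_right _ _))).le
    have hcof' : Order.cof (Iio lam.ord) ≠ ℵ₀ := by
      rw [Ordinal.cof_Iio, ← Ordinal.lift_cof]
      intro h
      rw [← lift_aleph0.{u + 1, u}, lift_inj] at h
      exact hcof.ne' h
    have hDK := hD.inter hcof' hK
    refine ⟨{c | ℵ₀ ≤ c ∧ ∃ h : c.ord < lam.ord, ⟨c.ord, h⟩ ∈ D}, ?_, ?_, ?_⟩
    · rintro c ⟨hc, h, -⟩
      exact ⟨hc, ord_lt_ord.1 h⟩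
    · intro c hc
      obtain ⟨x, ⟨hxD, d, hd, hdx⟩, hx⟩ := hDK.isCofinal ⟨_, ord_lt_ord.2 (hlim c hc)⟩
      refine ⟨d, ⟨hd, hdx ▸ x.2, ?_⟩, ?_⟩
      · convert hxD
        exact Subtype.ext hdx
      · have : (Order.succ c).ord ≤ x.1 := hx
        rw [← hdx, ord_le_ord] at this
        exact Order.succ_le_iff.1 this
    · intro μ hμS hμ A hA hAne hAμ
      -- Otherwise `μ` is the supremum of `A`, so its ordinal lies in the closed set `D`, which
      -- misses `S`.
      by_contra! hcon
      have hmem : (⟨μ.ord, ord_lt_ord.2 hμ⟩ : Iio lam.ord) ∈ D := by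
        refine hD.isLUB_mem (t := {x : Iio lam.ord | ∃ a ∈ A, a.ord = x}) ?_ ?_ ⟨?_, ?_⟩
        · rintro x ⟨a, ha, hax⟩
          obtain ⟨-, h, hD'⟩ := hA ha
          convert hD'
          exact Subtype.ext hax.symm
        · obtain ⟨a, ha⟩ := hAne
          obtain ⟨-, h, -⟩ := hA ha
          exact ⟨⟨a.ord, h⟩, a, ha, rfl⟩
        · rintro x ⟨a, ha, hax⟩
          change x.1 ≤ μ.ord
          rw [← hax]
          exact ord_le_ord.2 (hAμ a ha).le
        · intro b hb
          change μ.ord ≤ b.1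
          by_contra! hlt
          obtain ⟨a, ha, hab⟩ := hcon b.1.card (lt_ord.1 hlt)
          obtain ⟨-, h, -⟩ := hA ha
          have : a.ord ≤ b.1 := hb (a := ⟨a.ord, h⟩) ⟨a, ha, rfl⟩
          exact (ord_le.1 this).not_gt hab
      exact Set.disjoint_left.1 hdis ⟨μ, hμS, rfl⟩ hmem
  -- Countable cofinality: `C` is the range of a cofinal `ω`-sequence, so a part of it bounded below
  -- `lam` is finite and has a maximum.
  · push Not at hcof
    rw [← Ordinal.cof_toType] at hcof
    obtain ⟨s, hs, hscard⟩ := Order.exists_cof_eq (α := lam.ord.ToType)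
    have hscount : s.Countable := by
      rw [← le_aleph0_iff_set_countable, hscard]
      exact hcof
    have hsne : s.Nonempty := by
      have : Nonempty lam.ord.ToType := by
        rw [← mk_ne_zero_iff, mk_ord_toType]
        exact (aleph0_pos.trans hlam).ne'
      exact hs.nonempty
    obtain ⟨a, ha⟩ := hscount.exists_eq_range hsne
    let b : ℕ → Cardinal.{u} := fun n => #(Iio (a n))
    have hb : ∀ n, b n < lam := fun n => mk_Iio_lt_of_ord _
    have hbcof : ∀ c < lam, ∃ n, c ≤ b n := by
      intro c hc
      obtain ⟨j, hj⟩ := exists_typein_eq (ord_lt_ord.2 hc)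
      obtain ⟨x, hx, hjx⟩ := hs j
      rw [ha] at hx
      obtain ⟨n, rfl⟩ := hx
      refine ⟨n, ?_⟩
      rw [← card_ord c, ← hj, ← mk_Iio_toType]
      exact mk_le_mk_of_subset (Iio_subset_Iio hjx)
    let c : ℕ → Cardinal.{u} := fun n =>
      Nat.rec ℵ₀ (fun n c => Order.succ (max c (b n))) n
    have hcsucc : ∀ n, c (n + 1) = Order.succ (max (c n) (b n)) := fun n => rfl
    have hcmono : Monotone c := monotone_nat_of_le_succ fun n => by
      rw [hcsucc]
      exact (le_max_left _ _).trans (Order.le_succ _)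
    have hclt : ∀ n, c n < lam := by
      intro n
      induction n with
      | zero => exact hlam
      | succ n ih =>
        rw [hcsucc]
        exact hlim _ (max_lt ih (hb n))
    have hccof : ∀ d < lam, ∃ n, d < c n := by
      intro d hd
      obtain ⟨n, hn⟩ := hbcof d hd
      refine ⟨n + 1, ?_⟩
      rw [hcsucc]
      exact Order.lt_succ_iff.2 (hn.trans (le_max_right _ _))
    refine ⟨range c, ?_, ?_, ?_⟩
    · rintro _ ⟨n, rfl⟩
      exact ⟨hcmono (Nat.zero_le n), hclt n⟩
    · intro d hd
      obtain ⟨n, hn⟩ := hccof d hd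
      exact ⟨_, ⟨n, rfl⟩, hn⟩
    · intro μ _ hμ A hA hAne hAμ
      obtain ⟨n, hn⟩ := hccof μ hμ
      have hfin : A.Finite := by
        refine ((Set.finite_Iio n).image c).subset fun d hd => ?_
        obtain ⟨m, rfl⟩ := hA hd
        refine ⟨m, ?_, rfl⟩
        by_contra hnm
        exact ((hn.trans_le (hcmono (not_lt.1 hnm))).trans (hAμ _ hd)).false
      obtain ⟨ν, hν, hmax⟩ := Set.exists_max_image A id hfin hAne
      exact ⟨ν, hAμ ν hν, hmax⟩

/-- The sizes for a construction of length an initial ordinal below an uncountable cardinal. -/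
theorem exists_sizes {S : Set Cardinal.{u}} (hS : NowhereStationaryCardinals S)
    {lam c : Cardinal.{u}} (hlam : ℵ₀ < lam) (hc : c ≤ lam) :
    ∃ κ : c.ord.ToType → Cardinal.{u}, (∀ i, ℵ₀ ≤ κ i ∧ κ i < lam) ∧
      IsSizeBound S fun i => Order.succ (κ i) := by
  have hIio : ∀ i : c.ord.ToType, #(Iio i) < lam := fun i =>
    (mk_Iio_lt_of_ord i).trans_le hc
  by_cases hlim : ∀ d < lam, Order.succ d < lam
  · obtain ⟨C, hC, hCcof, hCgap⟩ := exists_cofinal_avoiding hS hlam hlim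
    -- The size at `i` is the least member of `C` above `#(Iio i)`.
    let A : c.ord.ToType → Set Cardinal.{u} := fun i => {d | d ∈ C ∧ #(Iio i) < d}
    have hA : ∀ i, (A i).Nonempty := fun i => hCcof _ (hIio i)
    have hmem : ∀ i, sInf (A i) ∈ A i := fun i => csInf_mem (hA i)
    have hmono : Monotone fun i => sInf (A i) := fun i j hij =>
      csInf_le_csInf' (hA j) fun d hd =>
        ⟨hd.1, (mk_le_mk_of_subset (Iio_subset_Iio hij)).trans_lt hd.2⟩
    refine ⟨fun i => sInf (A i), fun i => hC _ (hmem i).1,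
      isSizeBound_succ hmono (fun i => (hC _ (hmem i).1).1) (fun i => (hmem i).2.le) ?_⟩
    intro i μ hμS hne hlt
    rcases lt_or_ge μ lam with hμ | hμ
    · obtain ⟨ν, hν, hle⟩ := hCgap μ hμS hμ ((fun i => sInf (A i)) '' Iio i)
        (by rintro _ ⟨j, _, rfl⟩; exact (hmem j).1) (hne.image _)
        (by rintro _ ⟨j, hj, rfl⟩; exact hlt j hj)
      refine ⟨ν, hν, ?_, fun j hj => hle _ ⟨j, hj, rfl⟩⟩
      exact mk_Iio_le_of_forall_lt i fun j hj => (hmem j).2.trans_le (hle _ ⟨j, hj, rfl⟩)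
    · exact ⟨sInf (A i), (hC _ (hmem i).1).2.trans_le hμ, (hmem i).2.le,
        fun j hj => hmono (le_of_lt hj)⟩
  -- If `lam` is the successor of `κ`, the constant size `κ` works.
  · push Not at hlim
    obtain ⟨κ, hκ, hle⟩ := hlim
    have hlam' : Order.succ κ = lam := le_antisymm (Order.succ_le_iff.2 hκ) hle
    have hκinf : ℵ₀ ≤ κ := by rwa [← Order.lt_succ_iff, hlam']
    have hι : ∀ i : c.ord.ToType, #(Iio i) ≤ κ := fun i => by
      rw [← Order.lt_succ_iff, hlam']
      exact hIio i
    refine ⟨fun _ => κ, fun _ => ⟨hκinf, hκ⟩,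
      isSizeBound_succ monotone_const (fun _ => hκinf) hι ?_⟩
    rintro i μ - ⟨j, hj⟩ hlt
    exact ⟨κ, hlt j hj, hι i, fun _ _ => le_rfl⟩

/-! ### Induction on the size of the vertex set -/

/-- Almost disjoint families whose infinite members have sizes in a nowhere stationary set have
minimal covers. -/
theorem exists_isPrivateCover {S : Set Cardinal.{u}} (hS : NowhereStationaryCardinals S) (r : ℕ)
    (lam : Cardinal.{u}) (X : Set V) (𝓔 : Set (Set V)) (hX : #X ≤ lam) (hsub : ∀ E ∈ 𝓔, E ⊆ X)
    (hne : ∀ E ∈ 𝓔, E.Nonempty) (hsize : ∀ E ∈ 𝓔, E.Infinite → #E ∈ S)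
    (hr : AlmostDisjoint 𝓔 r) : ∃ Y, IsPrivateCover 𝓔 Y := by
  induction lam using Cardinal.lt_wf.induction generalizing X 𝓔 with
  | _ lam ih =>
    obtain ⟨e⟩ : Nonempty ((#𝓔).ord.ToType ≃ 𝓔) := Cardinal.eq.1 (mk_ord_toType _)
    rcases le_or_gt lam ℵ₀ with hlam | hlam
    · have h𝓔 : #𝓔 ≤ ℵ₀ := mk_le_of_almostDisjoint hr le_rfl (hX.trans hlam) hsub
      refine exists_isPrivateCover_of_isSizeBound hr hne hsize
        (isSizeBound_aleph0 S fun i => ?_) (fun _ => extendable_aleph0 𝓔 r) e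
      exact lt_aleph0_iff_set_finite.1 ((mk_Iio_lt_of_ord i).trans_le h𝓔)
    -- All sizes `κ i` are below `lam`, so the induction hypothesis applies to the closed sets in
    -- `extendable_succ`.
    · obtain ⟨κ, hκ, hbound⟩ := exists_sizes hS hlam
        (mk_le_of_almostDisjoint hr hlam.le hX hsub)
      exact exists_isPrivateCover_of_isSizeBound hr hne hsize hbound
        (fun i => extendable_succ hr hsize (hκ i).1 fun X' 𝓗 => ih (κ i) (hκ i).2 X' 𝓗) e

theorem PropertyC.almostDisjoint {𝓔 : Set (Set V)} {r : ℕ}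
    (h : PropertyC 𝓔 2 (r : Cardinal.{u})) : AlmostDisjoint 𝓔 r := by
  intro E hE E' hE' hne
  have hlt := h {E, E'} (insert_subset hE (singleton_subset_iff.2 hE')) (by
    rw [mk_insert (by simpa using hne), mk_singleton, Nat.cast_ofNat, one_add_one_eq_two])
  rw [sInter_pair] at hlt
  have hfin : (E ∩ E').Finite := lt_aleph0_iff_set_finite.1 (hlt.trans (natCast_lt_aleph0))
  rw [← hfin.cast_ncard_eq]
  rw [← Set.cast_ncard hfin] at hlt
  exact_mod_cast hlt

end Hypergraphs

theorem mainTheorem1 (S : Set Cardinal.{u}) (hS : NowhereStationaryCardinals S)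
    (lam : Cardinal.{u}) (r : ℕ) :
    Hypergraphs.MinVC lam S 2 (r : Cardinal.{u}) := by
  intro V _ 𝓔 hne hsize hC
  obtain ⟨Y, hY⟩ := Hypergraphs.exists_isPrivateCover hS r _ Set.univ 𝓔 le_rfl
    (fun E _ => Set.subset_univ E) hne (fun E hE _ => hsize hE) hC.almostDisjoint
  exact ⟨Y, hY.isMinimalVertexCover⟩
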